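/- A ReLU network is a map $x\mapsto W_L\,\sigma(\cdots\sigma(W_1x+b_1)\cdots)+b_L$ with real weight matrices $W_\ell$ and bias vectors $b_\ell$, where $\sigma(t)=\max\{0,t\}$ is applied coordinatewise after every affine map except the last. Its depth is the number $L\ge 1$ of affine maps, and its width is the largest dimension among all its layers (input, hidden and output). A network with $n^2$ inputs and $n^2$ outputs is regarded as a map on real $n\times n$ matrices by listing the entries row by row. Theorem. There are universal constants $C_1,C_2>0$ such that the following holds. Let $n\ge 1$ be an integer, let $M\ge 1$ and $\epsilon>0$ be real numbers, and put \[ K=\left\lceil \max\left\{ e\,n\,M,\ \frac{nM+\ln\left(\frac{\sqrt2}{\sqrt\pi\,\epsilon}\right)}{\ln 2}-1\right\}\right\rceil . \] Then there is a ReLU network $f_\epsilon$ with $n^2$ inputs and $n^2$ outputs such that \[ \sup_{A\in[-M,M]^{n\times n}}\left\|f_\epsilon(A)-e^A\right\|_F\le\epsilon , \] where $\|\cdot\|_F$ is the Frobenius norm and $[-M,M]^{n\times n}$ is the set of real $n\times n$ matrices with all entries in $[-M,M]$, and \[ \operatorname{width}(f_\epsilon)\le C_1\,K\,n^K, \] \[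 \operatorname{depth}(f_\epsilon)\le C_2\left[1+\ln K\cdot\max\left\{0,\ \ln K+\ln\left(\tfrac{2e}{\epsilon}\right)+K(\ln n+\ln M)\right\}\right]. \] The maximum with $0$ matters only when $\epsilon>2e\,K\,(nM)^K$; for all smaller $\epsilon$, in particular whenever $\epsilon<2e^n$, the depth bound is $C_2\left[1+\ln K\left(\ln K+\ln\left(\tfrac{2e}{\epsilon}\right)+K(\ln n+\ln M)\right)\right]$. -/

import Mathlib

open scoped Matrix
open scoped Matrix.Norms.Frobenius

/-- The ReLU activation function. -/
def relu (t : ℝ) : ℝ := max 0 t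

/-- Feedforward ReLU networks with `d` inputs and `m` outputs: affine maps with ReLU
activations, applied coordinatewise, between consecutive affine maps (and none after the
last one). -/
inductive ReLUNetwork : ℕ → ℕ → Type
  /-- The last layer: the affine map `x ↦ W x + b`. -/
  | output {d m : ℕ} (W : Matrix (Fin m) (Fin d) ℝ) (b : Fin m → ℝ) : ReLUNetwork d m
  /-- A hidden layer `x ↦ relu (W x + b)` with `h` neurons, followed by the network `N`. -/
  | hidden {d h m : ℕ} (W : Matrix (Fin h) (Fin d) ℝ) (b : Fin h → ℝ)
      (N : ReLUNetwork h m) : ReLUNetwork d m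

namespace ReLUNetwork

/-- The function computed by a network. -/
def eval {d m : ℕ} : ReLUNetwork d m → (Fin d → ℝ) → (Fin m → ℝ)
  | output W b, x => W *ᵥ x + b
  | hidden W b N, x => N.eval (fun i => relu ((W *ᵥ x + b) i))

/-- The width: the largest number of units in any layer, input and output layers included. -/
def width {d m : ℕ} : ReLUNetwork d m → ℕ
  | output _ _ => max d m
  | hidden _ _ N => max d N.width

/-- The depth: the number of affine maps, i.e. the number of hidden layers plus one. -/
def depth {d m : ℕ} : ReLUNetwork d m → ℕ
  | output _ _ => 1
  | hidden _ _ N => N.depth + 1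

/-- The map on `n × n` matrices computed by a network with `n * n` inputs and outputs; the
entries of matrices are enumerated row by row. -/
def evalMatrix {n : ℕ} (N : ReLUNetwork (n * n) (n * n)) (A : Matrix (Fin n) (Fin n) ℝ) :
    Matrix (Fin n) (Fin n) ℝ :=
  Matrix.of fun i j =>
    N.eval (fun p => A (finProdFinEquiv.symm p).1 (finProdFinEquiv.symm p).2)
      (finProdFinEquiv (i, j))

end ReLUNetwork

/-- The integer `K = ⌈max {e n M, (n M + ln (√2 / (√π ε))) / ln 2 - 1}⌉`. -/
noncomputable def truncationOrder (n : ℕ) (M ε : ℝ) : ℕ :=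
  ⌈max (Real.exp 1 * n * M)
    ((n * M + Real.log (√2 / (√Real.pi * ε))) / Real.log 2 - 1)⌉₊

/-! Scaling A by 1/(nM) puts it in the unit ball of the maximal row-sum norm, where all its powers
stay. A state holding candidates for every power up to 2^L is updated in parallel: slot k becomes
the product of slots ⌊k/2⌋ and ⌈k/2⌉. After L rounds all slots are filled, so a Taylor polynomial of
degree 2^L, comparable to K, costs only about ln K rounds.

Products come from squares by polarization, and squares from m + 1 sawtooth layers with error
4^(-m-1) (`abs_sqApprox_sub_sq_le`). A round turns an error e into at most 3e + θ, where θ =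
2n²/4^m, so L rounds lose at most 4^L θ (`rowSumLE_iterate_doubling`). The Taylor weights (nM)^k/k!
sum to at most e^(nM), so m must be of order ln(K e^(nM)/ε). The bracket D in the depth bound
dominates this because e^(nM-1) ≤ (nM)^K (`exp_sub_one_le_pow`). If ε ≥ 2e^(nM), the zero network
suffices. -/

/-! ### Composition and parallelization of ReLU networks -/

/-- Maps between finite-dimensional coordinate spaces of the form `x ↦ L x + b`, `L` linear. -/
def IsAffineFun {ι κ : Type} (f : (ι → ℝ) → (κ → ℝ)) : Prop :=
  ∃ (L : (ι → ℝ) →ₗ[ℝ] (κ → ℝ)) (b : κ → ℝ), ∀ x, f x = L x + b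

theorem IsAffineFun.comp {ι κ μ : Type} {g : (κ → ℝ) → (μ → ℝ)} {f : (ι → ℝ) → (κ → ℝ)}
    (hg : IsAffineFun g) (hf : IsAffineFun f) : IsAffineFun (fun x => g (f x)) := by
  obtain ⟨L, b, hL⟩ := hg
  obtain ⟨L', b', hL'⟩ := hf
  exact ⟨L ∘ₗ L', L b' + b, fun x => by simp [hL, hL', add_assoc]⟩

theorem isAffineFun_of_forall {ι κ : Type} [Fintype ι] {f : (ι → ℝ) → (κ → ℝ)}
    (W : κ → ι → ℝ) (b : κ → ℝ) (h : ∀ x k, f x k = (∑ i, W k i * x i) + b k) :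
    IsAffineFun f :=
  ⟨Matrix.mulVecLin (Matrix.of W), b, fun x => by
    ext k; simp [h, Matrix.mulVec, dotProduct]⟩

theorem isAffineFun_of_linear {ι κ : Type} {f : (ι → ℝ) → (κ → ℝ)}
    (hadd : ∀ x y, f (x + y) = f x + f y) (hsmul : ∀ (c : ℝ) x, f (c • x) = c • f x) :
    IsAffineFun f :=
  ⟨{ toFun := f, map_add' := hadd, map_smul' := hsmul }, 0, fun _ => (add_zero _).symm⟩

/-- `IsReLUMap w f h`: the map `f` is computed by a ReLU network with `h` hidden layers and
width at most `w`, whose layers are indexed by arbitrary finite types. -/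
inductive IsReLUMap (w : ℕ) : {ι κ : Type} → [Fintype ι] → [Fintype κ] →
    ((ι → ℝ) → (κ → ℝ)) → ℕ → Prop
  | affine {ι κ : Type} [Fintype ι] [Fintype κ] {f : (ι → ℝ) → (κ → ℝ)}
      (hf : IsAffineFun f) (hι : Fintype.card ι ≤ w) (hκ : Fintype.card κ ≤ w) :
      IsReLUMap w f 0
  | layer {ι μ κ : Type} [Fintype ι] [Fintype μ] [Fintype κ] {f : (ι → ℝ) → (μ → ℝ)}
      {g : (μ → ℝ) → (κ → ℝ)} {h : ℕ}
      (hf : IsAffineFun f) (hι : Fintype.card ι ≤ w) (hg : IsReLUMap w g h) :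
      IsReLUMap w (fun x => g (fun i => relu (f x i))) (h + 1)

namespace IsReLUMap

variable {w h : ℕ}

theorem comp_affine {ι κ μ : Type} [Fintype ι] [Fintype κ] [Fintype μ]
    {f : (ι → ℝ) → (κ → ℝ)} {g : (κ → ℝ) → (μ → ℝ)} (hg : IsReLUMap w g h)
    (hf : IsAffineFun f) (hι : Fintype.card ι ≤ w) : IsReLUMap w (fun x => g (f x)) h := by
  cases hg with
  | affine hg _ h2 => exact affine (hg.comp hf) hι h2
  | layer hg _ hN => exact layer (hg.comp hf) hι hN

/-- The final affine map of the inner network merges with the first affine map of the outer one, so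
hidden-layer counts add exactly and affine maps are free. -/
theorem comp {ι κ μ : Type} [Fintype ι] [Fintype κ] [Fintype μ]
    {f : (ι → ℝ) → (κ → ℝ)} {g : (κ → ℝ) → (μ → ℝ)} {h' : ℕ} (hg : IsReLUMap w g h')
    (hf : IsReLUMap w f h) : IsReLUMap w (fun x => g (f x)) (h + h') := by
  induction hf with
  | affine hf h1 h2 => simpa using hg.comp_affine hf h1
  | layer hf h1 _ ih =>
    rw [Nat.add_right_comm]
    exact layer hf h1 (ih hg)

/-- Applying one network in parallel to a family of inputs. -/
theorem blocks {ι κ : Type} [Fintype ι] [Fintype κ] {f : (ι → ℝ) → (κ → ℝ)}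
    (P : Type) [Fintype P] (hf : IsReLUMap w f h) :
    IsReLUMap (Fintype.card P * w)
      (fun (x : P × ι → ℝ) (q : P × κ) => f (fun i => x (q.1, i)) q.2) h := by
  have aux : ∀ {ι κ : Type} {f : (ι → ℝ) → (κ → ℝ)}, IsAffineFun f →
      IsAffineFun (fun (x : P × ι → ℝ) (q : P × κ) => f (fun i => x (q.1, i)) q.2) := by
    rintro ι κ f ⟨L, b, hL⟩
    refine ⟨{ toFun := fun x q => L (fun i => x (q.1, i)) q.2, map_add' := ?_,
              map_smul' := ?_ }, fun q => b q.2, ?_⟩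
    · intro x y
      ext q
      exact congrFun (L.map_add (fun i => x (q.1, i)) (fun i => y (q.1, i))) q.2
    · intro c x
      ext q
      exact congrFun (L.map_smul c (fun i => x (q.1, i))) q.2
    · intro x
      ext q
      simp [hL]
  induction hf with
  | affine hf h1 h2 =>
    refine affine (aux hf) ?_ ?_ <;> rw [Fintype.card_prod] <;> gcongr
  | layer hf h1 _ ih =>
    exact layer (aux hf) (by rw [Fintype.card_prod]; gcongr) ih

/-- Hidden layers may be numbered arbitrarily; only the input and output numberings `e`, `e'` affect
the computed function. -/
theorem exists_network {ι κ : Type} [Fintype ι] [Fintype κ] {f : (ι → ℝ) → (κ → ℝ)}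
    (hf : IsReLUMap w f h) : ∀ {d m : ℕ} (e : ι ≃ Fin d) (e' : κ ≃ Fin m),
    ∃ N : ReLUNetwork d m, N.width ≤ w ∧ N.depth = h + 1 ∧
      ∀ x k, N.eval x (e' k) = f (fun i => x (e i)) k := by
  have aux : ∀ {ι κ : Type} [Fintype ι] {f : (ι → ℝ) → (κ → ℝ)}, IsAffineFun f →
      ∀ {d m : ℕ} (e : ι ≃ Fin d) (e' : κ ≃ Fin m),
      ∃ (W : Matrix (Fin m) (Fin d) ℝ) (b : Fin m → ℝ),
        ∀ x k, (W *ᵥ x + b) k = f (fun i => x (e i)) (e'.symm k) := by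
    rintro ι κ _ f ⟨L, b, hL⟩ d m e e'
    classical
    refine ⟨Matrix.of fun k i => LinearMap.toMatrix' L (e'.symm k) (e.symm i),
      fun k => b (e'.symm k), fun x k => ?_⟩
    rw [hL, ← LinearMap.toMatrix'_mulVec L]
    simp only [Pi.add_apply, Matrix.mulVec, dotProduct, Matrix.of_apply]
    congr 1
    exact (Fintype.sum_equiv e _ _ (by simp)).symm
  induction hf with
  | affine hf h1 h2 =>
    intro d m e e'
    obtain ⟨W, b, hW⟩ := aux hf e e'
    refine ⟨.output W b, ?_, rfl, fun x k => ?_⟩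
    · rw [Fintype.card_congr e, Fintype.card_fin] at h1
      rw [Fintype.card_congr e', Fintype.card_fin] at h2
      exact max_le h1 h2
    · rw [ReLUNetwork.eval, hW, Equiv.symm_apply_apply]
  | @layer ι μ κ _ _ _ f g h hf h1 _ ih =>
    intro d m e e'
    obtain ⟨W, b, hW⟩ := aux hf e (Fintype.equivFin μ)
    obtain ⟨N, hw, hd, hN⟩ := ih (Fintype.equivFin μ) e'
    refine ⟨.hidden W b N, ?_, by rw [ReLUNetwork.depth, hd], fun x k => ?_⟩
    · rw [Fintype.card_congr e, Fintype.card_fin] at h1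
      exact max_le h1 hw
    · rw [ReLUNetwork.eval, hN]
      simp_rw [hW, Equiv.symm_apply_apply]

end IsReLUMap

/-! ### Squaring by sawtooth iteration -/

/-- One step of the sawtooth iteration: `y ↦ tent y` together with the accumulated sum. -/
noncomputable def sawStep (r : ℕ) (p : ℝ × ℝ) : ℝ × ℝ :=
  (2 * relu p.1 - 4 * relu (p.1 - 1 / 2),
    relu p.2 - (2 * relu p.1 - 4 * relu (p.1 - 1 / 2)) / 4 ^ (r + 1))

/-- The sawtooth iterates at `|t|` and the piecewise linear interpolants of the square. -/
noncomputable def sawState : ℕ → ℝ → ℝ × ℝ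
  | 0, t => (relu t + relu (-t), relu t + relu (-t))
  | r + 1, t => sawStep r (sawState r t)

/-- The piecewise linear approximation of `t ↦ t ^ 2` on `[-1, 1]` at level `m`. -/
noncomputable def sqApprox (m : ℕ) (t : ℝ) : ℝ := (sawState m t).2

theorem relu_of_nonneg {t : ℝ} (ht : 0 ≤ t) : relu t = t := max_eq_right ht

theorem relu_of_nonpos {t : ℝ} (ht : t ≤ 0) : relu t = 0 := max_eq_left ht

theorem relu_add_relu_neg (t : ℝ) : relu t + relu (-t) = |t| := by
  rcases le_total 0 t with ht | ht
  · rw [relu_of_nonneg ht, relu_of_nonpos (by linarith), abs_of_nonneg ht, add_zero]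
  · rw [relu_of_nonpos ht, relu_of_nonneg (by linarith), abs_of_nonpos ht, zero_add]

/-- The tent image y' of y satisfies 4(y - y²) = 2y' - y'², so subtracting y'/4^(r+1) turns the
remainder at level r into the one at level r + 1. Both components stay nonnegative, so the ReLUs
that carry them forward act as the identity. -/
theorem sawState_spec {t : ℝ} (ht : |t| ≤ 1) (m : ℕ) :
    0 ≤ (sawState m t).1 ∧ (sawState m t).1 ≤ 1 ∧
      (sawState m t).2 =
        t ^ 2 + ((sawState m t).1 - (sawState m t).1 ^ 2) / 4 ^ m := by
  induction m with
  | zero =>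
    simp only [sawState, relu_add_relu_neg, pow_zero, div_one, sq_abs]
    exact ⟨abs_nonneg t, ht, by ring⟩
  | succ r ih =>
    obtain ⟨h0, h1, h2⟩ := ih
    simp only [sawState, sawStep]
    have hs : 0 ≤ (sawState r t).2 := by
      rw [h2]
      have : 0 ≤ (sawState r t).1 - (sawState r t).1 ^ 2 := by nlinarith
      positivity
    rw [relu_of_nonneg hs, relu_of_nonneg h0, h2]
    generalize (sawState r t).1 = y at *
    have h4 : (4 : ℝ) ^ r ≠ 0 := by positivity
    rcases le_total y (1 / 2) with hy | hy
    · rw [relu_of_nonpos (by linarith)]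
      refine ⟨by linarith, by linarith, ?_⟩
      rw [pow_succ]
      field_simp
      ring
    · rw [relu_of_nonneg (by linarith)]
      refine ⟨by linarith, by linarith, ?_⟩
      rw [pow_succ]
      field_simp
      ring

/-- The remainder is (y - y²)/4^m, and y - y² ≤ 1/4. -/
theorem abs_sqApprox_sub_sq_le {t : ℝ} (ht : |t| ≤ 1) (m : ℕ) :
    |sqApprox m t - t ^ 2| ≤ 1 / 4 ^ (m + 1) := by
  obtain ⟨h0, h1, h2⟩ := sawState_spec ht m
  rw [sqApprox, h2, add_sub_cancel_left, pow_succ 4 m, abs_of_nonneg]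
  · rw [div_le_div_iff₀ (by positivity) (by positivity)]
    have : (0 : ℝ) < 4 ^ m := by positivity
    nlinarith [sq_nonneg ((sawState m t).1 - 1 / 2)]
  · have : 0 ≤ (sawState m t).1 - (sawState m t).1 ^ 2 := by nlinarith
    positivity

theorem isReLUMap_sawStep (r : ℕ) :
    IsReLUMap 3 (fun (x : Fin 2 → ℝ) =>
      ![(sawStep r (x 0, x 1)).1, (sawStep r (x 0, x 1)).2]) 1 := by
  have h1 : IsAffineFun (fun (x : Fin 2 → ℝ) => ![x 0, x 0 - 1 / 2, x 1]) :=
    isAffineFun_of_forall ![![1, 0], ![1, 0], ![0, 1]] ![0, -1 / 2, 0] (by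
      intro x k
      fin_cases k <;> simp [Fin.sum_univ_two]
      ring)
  have h2 : IsAffineFun (fun (z : Fin 3 → ℝ) =>
      ![2 * z 0 - 4 * z 1, z 2 - (2 * z 0 - 4 * z 1) / 4 ^ (r + 1)]) :=
    isAffineFun_of_forall ![![2, -4, 0], ![-2 / 4 ^ (r + 1), 4 / 4 ^ (r + 1), 1]] 0 (by
      intro x k
      fin_cases k <;> simp [Fin.sum_univ_three] <;> ring)
  have := IsReLUMap.layer (w := 3) h1 (by simp) (IsReLUMap.affine h2 (by simp) (by simp))
  exact this

/-- One hidden layer forms |t|; each of the m sawtooth steps adds one more. -/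
theorem isReLUMap_sawState (m : ℕ) :
    IsReLUMap 3 (fun (x : Unit → ℝ) =>
      ![(sawState m (x ())).1, (sawState m (x ())).2]) (m + 1) := by
  induction m with
  | zero =>
    have h1 : IsAffineFun (fun (x : Unit → ℝ) => ![x (), -x ()]) :=
      isAffineFun_of_forall ![![1] ∘ default, ![-1] ∘ default] 0 (by
        intro x k
        fin_cases k <;> simp)
    have h2 : IsAffineFun (fun (z : Fin 2 → ℝ) => ![z 0 + z 1, z 0 + z 1]) :=
      isAffineFun_of_forall ![![1, 1], ![1, 1]] 0 (by
        intro x k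
        fin_cases k <;> simp [Fin.sum_univ_two])
    have := IsReLUMap.layer (w := 3) h1 (by simp) (IsReLUMap.affine h2 (by simp) (by simp))
    exact this
  | succ r ih =>
    exact (isReLUMap_sawStep r).comp ih

theorem isReLUMap_sqApprox (m : ℕ) :
    IsReLUMap 3 (fun (x : Unit → ℝ) (_ : Unit) => sqApprox m (x ())) (m + 1) := by
  have h : IsAffineFun (fun (z : Fin 2 → ℝ) (_ : Unit) => z 1) :=
    isAffineFun_of_forall (fun _ => ![0, 1]) 0 (by simp [Fin.sum_univ_two])
  exact (IsReLUMap.affine (w := 3) h (by simp) (by simp)).comp (isReLUMap_sawState m)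

/-! ### Approximate multiplication -/

/-- Approximate multiplication by polarization of the approximate square. -/
noncomputable def approxMul (m : ℕ) (a b : ℝ) : ℝ :=
  4 * (sqApprox m ((a + b) / 4) - sqApprox m ((a - b) / 4))

/-- Dividing by 4 keeps both squared arguments in [-1, 1]. The bound 2, rather than 1, on the
factors leaves room for perturbed entries of powers. -/
theorem abs_approxMul_sub_le (m : ℕ) {a b : ℝ} (ha : |a| ≤ 2) (hb : |b| ≤ 2) :
    |approxMul m a b - a * b| ≤ 2 / 4 ^ m := by
  rw [abs_le] at ha hb
  have h1 := abs_sqApprox_sub_sq_le (t := (a + b) / 4)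
    (by rw [abs_le]; constructor <;> linarith [ha.1, ha.2, hb.1, hb.2]) m
  have h2 := abs_sqApprox_sub_sq_le (t := (a - b) / 4)
    (by rw [abs_le]; constructor <;> linarith [ha.1, ha.2, hb.1, hb.2]) m
  have h3 : (2 : ℝ) / 4 ^ m = 8 * (1 / 4 ^ (m + 1)) := by
    rw [pow_succ]; field_simp; norm_num
  rw [h3, approxMul]
  generalize (1 : ℝ) / 4 ^ (m + 1) = η at *
  rw [abs_le] at *
  constructor <;> nlinarith [h1.1, h1.2, h2.1, h2.2]

/-! ### The network computing all powers in parallel -/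

/-- Indices of the entries of `T + 1` matrices of size `n × n`. -/
abbrev PowerIndex (T n : ℕ) : Type := Fin (T + 1) × (Fin n × Fin n)

/-- The index `⌊k / 2⌋`. -/
def floorHalf {T : ℕ} (k : Fin (T + 1)) : Fin (T + 1) := ⟨k / 2, by omega⟩

/-- The index `⌈k / 2⌉`. -/
def ceilHalf {T : ℕ} (k : Fin (T + 1)) : Fin (T + 1) := ⟨(k + 1) / 2, by omega⟩

/-- Replace the `k`-th matrix by the approximate product of those at `⌊k / 2⌋`, `⌈k / 2⌉`. -/
noncomputable def doubling (m T n : ℕ) (s : PowerIndex T n → ℝ) (q : PowerIndex T n) : ℝ :=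
  ∑ j, approxMul m (s (floorHalf q.1, q.2.1, j)) (s (ceilHalf q.1, j, q.2.2))

/-- Each output entry needs one width-3 squaring block per summation index and per sign in the
polarization identity. -/
theorem isReLUMap_doubling (m T n : ℕ) :
    IsReLUMap ((T + 1) * (n * n) * (n * 2) * 3) (doubling m T n) (m + 1) := by
  have h1 : IsAffineFun (fun (s : PowerIndex T n → ℝ)
      (p : (PowerIndex T n × Fin n × Bool) × Unit) =>
      (s (floorHalf p.1.1.1, p.1.1.2.1, p.1.2.1) + (if p.1.2.2 then 1 else -1) *
        s (ceilHalf p.1.1.1, p.1.2.1, p.1.1.2.2)) / 4) := by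
    refine isAffineFun_of_linear (fun x y => ?_) fun c x => ?_
    · ext p
      simp only [Pi.add_apply]
      ring
    · ext p
      simp only [Pi.smul_apply, smul_eq_mul]
      ring
  have h2 : IsAffineFun (fun (z : (PowerIndex T n × Fin n × Bool) × Unit → ℝ)
      (q : PowerIndex T n) => ∑ j, 4 * (z ((q, j, true), ()) - z ((q, j, false), ()))) := by
    refine isAffineFun_of_linear (fun x y => ?_) fun c x => ?_
    · ext p
      simp only [Pi.add_apply]
      rw [← Finset.sum_add_distrib]
      exact Finset.sum_congr rfl fun _ _ => by ring
    · ext p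
      simp only [Pi.smul_apply, smul_eq_mul]
      rw [Finset.mul_sum]
      exact Finset.sum_congr rfl fun _ _ => by ring
  have hb := (isReLUMap_sqApprox m).blocks (PowerIndex T n × Fin n × Bool)
  have hP : Fintype.card (PowerIndex T n × Fin n × Bool) = (T + 1) * (n * n) * (n * 2) := by
    simp [PowerIndex]
  have hs : Fintype.card (PowerIndex T n) ≤ (T + 1) * (n * n) * (n * 2) * 3 := by
    simp only [PowerIndex, Fintype.card_prod, Fintype.card_fin]
    rcases Nat.eq_zero_or_pos n with rfl | hn
    · simp
    · rw [mul_assoc]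
      exact Nat.le_mul_of_pos_right _ (by omega)
  rw [hP] at hb
  have h3 := ((IsReLUMap.affine (w := (T + 1) * (n * n) * (n * 2) * 3) h2
    (by rw [Fintype.card_prod, hP, Fintype.card_unit]; omega) hs).comp
    hb).comp_affine h1 hs
  refine (congrArg (fun f => IsReLUMap ((T + 1) * (n * n) * (n * 2) * 3) f (m + 1)) ?_).mp h3
  funext s q
  refine Finset.sum_congr rfl fun j _ => ?_
  simp [approxMul, sub_eq_add_neg]

/-- The state from which the approximate powers are computed: the identity at `0` and
copies of `c • A` elsewhere. -/
noncomputable def powerInit (T n : ℕ) (c : ℝ) (x : Fin n × Fin n → ℝ) (q : PowerIndex T n) : ℝ :=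
  if q.1 = 0 then (if q.2.1 = q.2.2 then 1 else 0) else c * x q.2

theorem isAffineFun_powerInit (T n : ℕ) (c : ℝ) : IsAffineFun (powerInit T n c) := by
  refine ⟨{ toFun := fun x q => if q.1 = 0 then 0 else c * x q.2, map_add' := fun x y => ?_,
            map_smul' := fun r x => ?_ },
    fun q => if q.1 = 0 then (if q.2.1 = q.2.2 then 1 else 0) else 0, fun x => ?_⟩
  · ext p
    by_cases h : p.1 = 0 <;> simp [h, mul_add]
  · ext p
    by_cases h : p.1 = 0 <;> simp [h, mul_left_comm]
  · ext p
    by_cases h : p.1 = 0 <;> simp [powerInit, h]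

/-- A linear combination of the `T + 1` matrices in a state. -/
noncomputable def powerSum (T n : ℕ) (a : ℕ → ℝ) (s : PowerIndex T n → ℝ) (p : Fin n × Fin n) : ℝ :=
  ∑ k : Fin (T + 1), a k * s (k, p)

theorem isAffineFun_powerSum (T n : ℕ) (a : ℕ → ℝ) : IsAffineFun (powerSum T n a) := by
  refine isAffineFun_of_linear (fun x y => ?_) fun r x => ?_
  · ext p
    simp [powerSum, mul_add, Finset.sum_add_distrib]
  · ext p
    simp [powerSum, mul_left_comm, Finset.mul_sum]

/-- The approximation of the matrix polynomial `∑ k ≤ T, a k • (c • A) ^ k`. -/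
noncomputable def approxPoly (m T n L : ℕ) (c : ℝ) (a : ℕ → ℝ) (x : Fin n × Fin n → ℝ) :
    Fin n × Fin n → ℝ :=
  powerSum T n a ((doubling m T n)^[L] (powerInit T n c x))

theorem isReLUMap_approxPoly {n : ℕ} (hn : 1 ≤ n) (m T L : ℕ) (c : ℝ) (a : ℕ → ℝ) :
    IsReLUMap ((T + 1) * (n * n) * (n * 2) * 3) (approxPoly m T n L c a) (L * (m + 1)) := by
  have hn2 : n * n ≤ (T + 1) * (n * n) * (n * 2) * 3 := by
    calc n * n ≤ n * n * ((T + 1) * (n * 2) * 3) := Nat.le_mul_of_pos_right _ (by positivity)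
      _ = _ := by ring
  have hs : (T + 1) * (n * n) ≤ (T + 1) * (n * n) * (n * 2) * 3 := by
    rw [mul_assoc _ _ 3]
    exact Nat.le_mul_of_pos_right _ (by omega)
  have hit : IsReLUMap ((T + 1) * (n * n) * (n * 2) * 3) ((doubling m T n)^[L])
      (L * (m + 1)) := by
    induction L with
    | zero =>
      refine (zero_mul (m + 1)).symm ▸ IsReLUMap.affine ⟨LinearMap.id, 0, fun x => by simp⟩ ?_ ?_ <;>
      simpa [PowerIndex] using hs
    | succ L ih =>
      rw [Function.iterate_succ', add_mul L, one_mul]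
      exact (isReLUMap_doubling m T n).comp ih
  have h1 : IsReLUMap ((T + 1) * (n * n) * (n * 2) * 3) (powerSum T n a) 0 :=
    IsReLUMap.affine (isAffineFun_powerSum T n a)
      (by simpa [PowerIndex] using hs) (by simpa using hn2)
  exact (h1.comp hit).comp_affine (isAffineFun_powerInit T n c) (by simpa using hn2)

/-! ### Error propagation in the row-sum norm -/

/-- Expanding S S' - ab around a and b gives three terms of size at most e; e ≤ 1 absorbs the
quadratic one. -/
theorem norm_sub_mul_le_of_approx {R : Type*} [NormedRing R] {a b S S' U : R} {e η : ℝ}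
    (ha : ‖a‖ ≤ 1) (hb : ‖b‖ ≤ 1) (he : e ≤ 1) (hS : ‖S - a‖ ≤ e) (hS' : ‖S' - b‖ ≤ e)
    (hU : ‖U - S * S'‖ ≤ η) : ‖U - a * b‖ ≤ 3 * e + η := by
  have he0 : 0 ≤ e := (norm_nonneg _).trans hS
  have h : U - a * b = (U - S * S') + ((S - a) * (S' - b) + (S - a) * b + a * (S' - b)) := by
    noncomm_ring
  rw [h]
  have h1 : ‖(S - a) * (S' - b)‖ ≤ e * 1 :=
    (norm_mul_le _ _).trans (mul_le_mul hS (hS'.trans he) (norm_nonneg _) he0)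
  have h2 : ‖(S - a) * b‖ ≤ e * 1 :=
    (norm_mul_le _ _).trans (mul_le_mul hS hb (norm_nonneg _) he0)
  have h3 : ‖a * (S' - b)‖ ≤ 1 * e :=
    (norm_mul_le _ _).trans (mul_le_mul ha hS' (norm_nonneg _) zero_le_one)
  have h4 := norm_add_le (U - S * S') ((S - a) * (S' - b) + (S - a) * b + a * (S' - b))
  have h5 := norm_add₃_le (a := (S - a) * (S' - b)) (b := (S - a) * b) (c := a * (S' - b))
  linarith

theorem norm_mul_le_one_of_le {R : Type*} [NormedRing R] {a b : R} (ha : ‖a‖ ≤ 1)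
    (hb : ‖b‖ ≤ 1) : ‖a * b‖ ≤ 1 :=
  (norm_mul_le a b).trans (mul_le_one₀ ha (norm_nonneg b) hb)

/-- The maximal absolute row sum is at most `r`. -/
def RowSumLE {n : ℕ} (A : Matrix (Fin n) (Fin n) ℝ) (r : ℝ) : Prop :=
  ∀ i, ∑ j, |A i j| ≤ r

/-- Access to submultiplicativity of the row-sum norm, passed explicitly because the ambient
instance is Frobenius. In the Frobenius norm the identity has norm √n, so the zeroth power would
leave the unit ball. -/
theorem rowSumLE_iff {n : ℕ} (A : Matrix (Fin n) (Fin n) ℝ) {r : ℝ} (hr : 0 ≤ r) :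
    RowSumLE A r ↔ (Matrix.linftyOpNormedRing (α := ℝ) (n := Fin n)).norm A ≤ r := by
  lift r to NNReal using hr
  have h := Matrix.linfty_opNNNorm_def A
  have h2 : (Matrix.linftyOpNormedRing (α := ℝ) (n := Fin n)).norm A =
    ((Finset.univ.sup fun i : Fin n => ∑ j : Fin n, ‖A i j‖₊ : NNReal) : ℝ) := by
    rw [← h]; rfl
  rw [h2, NNReal.coe_le_coe, Finset.sup_le_iff]
  simp only [RowSumLE, Finset.mem_univ, true_imp_iff, ← NNReal.coe_le_coe, NNReal.coe_sum,
    coe_nnnorm, Real.norm_eq_abs]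

namespace RowSumLE

variable {n : ℕ}

theorem one : RowSumLE (1 : Matrix (Fin n) (Fin n) ℝ) 1 := by
  intro i
  simp [Matrix.one_apply, apply_ite abs]

theorem pow {A : Matrix (Fin n) (Fin n) ℝ} (hA : RowSumLE A 1) (k : ℕ) :
    RowSumLE (A ^ k) 1 := by
  induction k with
  | zero => simpa using one
  | succ k ih =>
    rw [rowSumLE_iff _ zero_le_one] at *
    rw [pow_succ]
    exact @norm_mul_le_one_of_le _ (Matrix.linftyOpNormedRing (α := ℝ) (n := Fin n)) _ _ ih hA

theorem sub_mul_of_approx {a b S S' U : Matrix (Fin n) (Fin n) ℝ} {e η : ℝ} (he0 : 0 ≤ e)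
    (hη : 0 ≤ η) (ha : RowSumLE a 1) (hb : RowSumLE b 1) (he : e ≤ 1) (hS : RowSumLE (S - a) e)
    (hS' : RowSumLE (S' - b) e) (hU : RowSumLE (U - S * S') η) :
    RowSumLE (U - a * b) (3 * e + η) := by
  rw [rowSumLE_iff _ (by positivity)] at *
  exact @norm_sub_mul_le_of_approx _ (Matrix.linftyOpNormedRing (α := ℝ) (n := Fin n))
    _ _ _ _ _ _ _ ha hb he hS hS' hU

theorem abs_le {A : Matrix (Fin n) (Fin n) ℝ} {r : ℝ} (hA : RowSumLE A r) (i j : Fin n) :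
    |A i j| ≤ r :=
  (Finset.single_le_sum (f := fun j => |A i j|) (fun _ _ => abs_nonneg _)
    (Finset.mem_univ j)).trans (hA i)

theorem frobenius_norm_le {A : Matrix (Fin n) (Fin n) ℝ} {r : ℝ} (hr : 0 ≤ r)
    (hA : RowSumLE A r) : ‖A‖ ≤ n * r := by
  rw [Matrix.frobenius_norm_def]
  have h : ∑ i, ∑ j, ‖A i j‖ ^ (2 : ℝ) ≤ (n * r) ^ 2 := by
    have h1 : ∀ i, ∑ j, ‖A i j‖ ^ (2 : ℝ) ≤ r ^ 2 := by
      intro i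
      calc ∑ j, ‖A i j‖ ^ (2 : ℝ) ≤ ∑ j, |A i j| * r := by
            refine Finset.sum_le_sum fun j _ => ?_
            rw [Real.rpow_two, Real.norm_eq_abs, sq]
            exact mul_le_mul_of_nonneg_left (hA.abs_le i j) (abs_nonneg _)
        _ ≤ r ^ 2 := by
            rw [← Finset.sum_mul, sq]
            exact mul_le_mul_of_nonneg_right (hA i) hr
    calc ∑ i, ∑ j, ‖A i j‖ ^ (2 : ℝ) ≤ ∑ i : Fin n, r ^ 2 :=
          Finset.sum_le_sum fun i _ => h1 i
      _ = n * r ^ 2 := by simp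
      _ ≤ (n * r) ^ 2 := by
          rw [mul_pow]
          refine mul_le_mul_of_nonneg_right ?_ (sq_nonneg r)
          exact_mod_cast Nat.le_self_pow two_ne_zero n
  rw [← Real.sqrt_eq_rpow]
  exact Real.sqrt_le_iff.mpr ⟨by positivity, h⟩

end RowSumLE

/-- The `k`-th matrix of a state. -/
def stateMatrix {T n : ℕ} (s : PowerIndex T n → ℝ) (k : Fin (T + 1)) :
    Matrix (Fin n) (Fin n) ℝ :=
  Matrix.of fun i j => s (k, i, j)

theorem rowSumLE_doubling_sub {m T n : ℕ} {s : PowerIndex T n → ℝ} {k : Fin (T + 1)}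
    (h1 : ∀ i j, |s (floorHalf k, i, j)| ≤ 2) (h2 : ∀ i j, |s (ceilHalf k, i, j)| ≤ 2) :
    RowSumLE (stateMatrix (doubling m T n s) k -
      stateMatrix s (floorHalf k) * stateMatrix s (ceilHalf k)) (2 * n ^ 2 / 4 ^ m) := by
  intro i
  have h : ∀ j, |(stateMatrix (doubling m T n s) k -
      stateMatrix s (floorHalf k) * stateMatrix s (ceilHalf k)) i j| ≤ n * (2 / 4 ^ m) := by
    intro j
    simp only [stateMatrix, doubling, Matrix.sub_apply, Matrix.of_apply, Matrix.mul_apply,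
      ← Finset.sum_sub_distrib]
    refine (Finset.abs_sum_le_sum_abs _ _).trans ?_
    refine (Finset.sum_le_sum fun l _ => abs_approxMul_sub_le m (h1 i l) (h2 l j)).trans ?_
    simp
  refine (Finset.sum_le_sum fun j _ => h j).trans (le_of_eq ?_)
  simp
  ring

/-- The recursion closes since 3(4^j - 1) + 1 ≤ 4^(j+1) - 1. Slots beyond 2^j may be wrong after j
rounds, but slots up to 2^(j+1) only read halves at most 2^j. The hypothesis `hL` keeps every error
at most 1, hence the entries read at most 2, where `approxMul` is accurate. -/
theorem rowSumLE_iterate_doubling {m T n : ℕ} {c : ℝ} {A : Matrix (Fin n) (Fin n) ℝ}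
    (hA : RowSumLE (c • A) 1) {L : ℕ} (hL : (4 : ℝ) ^ L * (2 * n ^ 2 / 4 ^ m) ≤ 1) :
    ∀ j ≤ L, ∀ k : Fin (T + 1), (k : ℕ) ≤ 2 ^ j →
      RowSumLE (stateMatrix ((doubling m T n)^[j] (powerInit T n c fun p => A p.1 p.2)) k -
        (c • A) ^ (k : ℕ)) ((4 ^ j - 1) * (2 * n ^ 2 / 4 ^ m)) := by
  have hθ : (0 : ℝ) ≤ 2 * n ^ 2 / 4 ^ m := by positivity
  intro j
  induction j with
  | zero =>
    intro _ k hk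
    have h0 : stateMatrix (powerInit T n c fun p => A p.1 p.2) k = (c • A) ^ (k : ℕ) := by
      ext i l
      by_cases hk0 : k = 0
      · subst hk0
        simp [stateMatrix, powerInit, Matrix.one_apply]
      · have : (k : ℕ) = 1 := by
          have : (k : ℕ) ≠ 0 := fun h => hk0 (Fin.ext h)
          omega
        rw [this]
        simp [stateMatrix, powerInit, hk0]
    intro i
    simp [h0]
  | succ j ih =>
    intro hj k hk
    have ih := ih (by omega)
    rw [Function.iterate_succ_apply']
    set s := (doubling m T n)^[j] (powerInit T n c fun p => A p.1 p.2)
    set θ : ℝ := 2 * n ^ 2 / 4 ^ m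
    have h41 : (1 : ℝ) ≤ 4 ^ j := one_le_pow₀ (by norm_num)
    have he0 : 0 ≤ ((4 : ℝ) ^ j - 1) * θ := mul_nonneg (by linarith) hθ
    have he : ((4 : ℝ) ^ j - 1) * θ ≤ 1 := by
      refine le_trans ?_ hL
      refine mul_le_mul_of_nonneg_right ?_ hθ
      have : (4 : ℝ) ^ j ≤ 4 ^ L := pow_le_pow_right₀ (by norm_num) (by omega)
      linarith
    have key : ∀ k : Fin (T + 1), (k : ℕ) ≤ 2 ^ j → ∀ i l, |s (k, i, l)| ≤ 2 := by
      intro k hk i l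
      have a1 := (ih k hk).abs_le i l
      have a2 := (hA.pow k).abs_le i l
      have a3 : s (k, i, l) = (stateMatrix s k - (c • A) ^ (k : ℕ)) i l
        + ((c • A) ^ (k : ℕ)) i l := by simp [stateMatrix]
      rw [a3]
      refine (abs_add_le _ _).trans ?_
      linarith
    have hf : ((floorHalf k : Fin (T + 1)) : ℕ) ≤ 2 ^ j := by
      simp only [floorHalf]; rw [pow_succ] at hk; omega
    have hc : ((ceilHalf k : Fin (T + 1)) : ℕ) ≤ 2 ^ j := by
      simp only [ceilHalf]; rw [pow_succ] at hk; omega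
    have h := RowSumLE.sub_mul_of_approx he0 hθ (hA.pow _) (hA.pow _) he (ih _ hf) (ih _ hc)
      (rowSumLE_doubling_sub (m := m) (key _ hf) (key _ hc))
    have hk2 : (k : ℕ) = (floorHalf k : Fin (T + 1)) + (ceilHalf k : Fin (T + 1)) := by
      simp only [floorHalf, ceilHalf]; omega
    rw [hk2, pow_add]
    intro i
    refine (h i).trans ?_
    rw [pow_succ]
    nlinarith

theorem norm_approxPoly_sub_le {m n L : ℕ} {c : ℝ} {a : ℕ → ℝ} {A : Matrix (Fin n) (Fin n) ℝ}
    (hA : RowSumLE (c • A) 1) (ha : ∀ k, 0 ≤ a k)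
    (hL : (4 : ℝ) ^ L * (2 * n ^ 2 / 4 ^ m) ≤ 1) :
    ‖(Matrix.of fun i j => approxPoly m (2 ^ L) n L c a (fun p => A p.1 p.2) (i, j)) -
        ∑ k ∈ Finset.range (2 ^ L + 1), a k • (c • A) ^ k‖ ≤
      (∑ k ∈ Finset.range (2 ^ L + 1), a k) * (n * (4 ^ L * (2 * n ^ 2 / 4 ^ m))) := by
  have h : (Matrix.of fun i j => approxPoly m (2 ^ L) n L c a (fun p => A p.1 p.2) (i, j)) -
        ∑ k ∈ Finset.range (2 ^ L + 1), a k • (c • A) ^ k =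
      ∑ k : Fin (2 ^ L + 1), a k • (stateMatrix ((doubling m (2 ^ L) n)^[L]
        (powerInit (2 ^ L) n c fun p => A p.1 p.2)) k - (c • A) ^ (k : ℕ)) := by
    rw [Finset.sum_range]
    simp only [smul_sub, Finset.sum_sub_distrib]
    congr 1
    ext i j
    simp [approxPoly, powerSum, stateMatrix, Matrix.sum_apply]
  rw [h, Finset.sum_range, Finset.sum_mul]
  refine (norm_sum_le _ _).trans (Finset.sum_le_sum fun k _ => ?_)
  rw [norm_smul, Real.norm_of_nonneg (ha k)]
  refine mul_le_mul_of_nonneg_left ?_ (ha k)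
  have hθ : (0 : ℝ) ≤ 2 * n ^ 2 / 4 ^ m := by positivity
  refine RowSumLE.frobenius_norm_le (by positivity) fun i => ?_
  refine (rowSumLE_iterate_doubling hA hL L le_rfl k (by omega) i).trans ?_
  exact mul_le_mul_of_nonneg_right (by linarith) hθ

/-! ### Taylor remainder and size of the exponential -/

/-- Since ‖1‖ = 1 is not assumed, ‖a^k‖ ≤ ‖a‖^k is available only for k > 0, hence 1 ≤ N. -/
theorem norm_exp_sub_sum_le {R : Type*} [NormedRing R] [NormedAlgebra ℝ R] [CompleteSpace R]
    {a : R} {x : ℝ} (ha : ‖a‖ ≤ x) {N : ℕ} (hN : 1 ≤ N) {g : ℕ → ℝ} {r : ℝ} (hg : HasSum g r)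
    (h : ∀ k, x ^ (k + N) / (k + N).factorial ≤ g k) :
    ‖NormedSpace.exp a - ∑ k ∈ Finset.range N, ((k.factorial : ℝ)⁻¹) • a ^ k‖ ≤ r := by
  have h1 := (hasSum_nat_add_iff' N).mpr (NormedSpace.exp_series_hasSum_exp' (𝕂 := ℝ) a)
  refine h1.norm_le_of_bounded hg fun k => le_trans ?_ (h k)
  rw [norm_smul, norm_inv, Real.norm_natCast, div_eq_inv_mul]
  refine mul_le_mul_of_nonneg_left ?_ (by positivity)
  exact (norm_pow_le' a (by omega)).trans (pow_le_pow_left₀ (norm_nonneg a) ha _)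

/-- From k^k/k! ≤ e^k, a single term of the series for e^k. -/
theorem pow_div_factorial_le_quarter_pow {x : ℝ} (hx : 0 ≤ x) {k : ℕ}
    (hk : 4 * (Real.exp 1 * x) ≤ k) : x ^ k / k.factorial ≤ (1 / 4) ^ k := by
  have h1 : (k : ℝ) ^ k / k.factorial ≤ Real.exp 1 ^ k := by
    rw [← Real.exp_nat_mul, mul_one]
    exact Real.pow_div_factorial_le_exp k (by positivity) k
  have h2 : (4 * (Real.exp 1 * x)) ^ k / k.factorial ≤ Real.exp 1 ^ k :=
    le_trans (by gcongr) h1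
  have he : (0 : ℝ) < Real.exp 1 ^ k := by positivity
  rw [mul_pow, mul_pow] at h2
  have h3 : Real.exp 1 ^ k * (4 ^ k * (x ^ k / k.factorial)) ≤ Real.exp 1 ^ k * 1 := by
    calc _ = 4 ^ k * (Real.exp 1 ^ k * x ^ k) / k.factorial := by ring
      _ ≤ _ := by rw [mul_one]; exact h2
  have h4 := le_of_mul_le_mul_left h3 he
  rw [one_div, inv_pow, ← one_div, le_div_iff₀ (by positivity), mul_comm]
  exact h4

theorem norm_exp_sub_taylor_le {R : Type*} [NormedRing R] [NormedAlgebra ℝ R] [CompleteSpace R]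
    {a : R} {x : ℝ} (ha : ‖a‖ ≤ x) {N : ℕ} (hN : 1 ≤ N) (hx : 4 * (Real.exp 1 * x) ≤ N) :
    ‖NormedSpace.exp a - ∑ k ∈ Finset.range N, ((k.factorial : ℝ)⁻¹) • a ^ k‖ ≤
      (1 / 4) ^ N * (4 / 3) := by
  have hg : HasSum (fun k : ℕ => (1 / 4 : ℝ) ^ N * (1 / 4) ^ k) ((1 / 4) ^ N * (4 / 3)) := by
    have := (hasSum_geometric_of_lt_one (r := (1 / 4 : ℝ)) (by norm_num) (by norm_num)).mul_left
      ((1 / 4 : ℝ) ^ N)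
    norm_num at this ⊢
    exact this
  refine norm_exp_sub_sum_le ha hN hg fun k => ?_
  rw [← pow_add, add_comm N k]
  refine pow_div_factorial_le_quarter_pow ((norm_nonneg a).trans ha) (hx.trans ?_)
  push_cast
  linarith [(Nat.cast_nonneg k : (0 : ℝ) ≤ k)]

theorem norm_exp_le_norm_one_add {R : Type*} [NormedRing R] [NormedAlgebra ℝ R]
    [CompleteSpace R] {a : R} {x : ℝ} (ha : ‖a‖ ≤ x) :
    ‖NormedSpace.exp a‖ ≤ ‖(1 : R)‖ + (Real.exp x - 1) := by
  have h1 := (hasSum_nat_add_iff' 1).mpr (NormedSpace.expSeries_div_hasSum_exp (𝔸 := ℝ) x)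
  have h2 := norm_exp_sub_sum_le ha le_rfl h1 fun k => le_rfl
  simp only [Finset.range_one, Finset.sum_singleton, Nat.factorial_zero, Nat.cast_one, inv_one,
    pow_zero, one_smul, div_one, ← Real.exp_eq_exp_ℝ] at h2
  have h3 := norm_le_norm_add_norm_sub' (NormedSpace.exp a) 1
  linarith

theorem frobenius_norm_le_of_forall_abs_le {n : ℕ} {A : Matrix (Fin n) (Fin n) ℝ} {M : ℝ}
    (hM : 0 ≤ M) (hA : ∀ i j, |A i j| ≤ M) : ‖A‖ ≤ n * M := by
  rw [Matrix.frobenius_norm_def, ← Real.sqrt_eq_rpow]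
  refine Real.sqrt_le_iff.mpr ⟨by positivity, ?_⟩
  calc ∑ i, ∑ j, ‖A i j‖ ^ (2 : ℝ) ≤ ∑ i : Fin n, ∑ j : Fin n, M ^ 2 := by
        refine Finset.sum_le_sum fun i _ => Finset.sum_le_sum fun j _ => ?_
        rw [Real.rpow_two, Real.norm_eq_abs]
        exact pow_le_pow_left₀ (abs_nonneg _) (hA i j) 2
    _ = (n * M) ^ 2 := by simp; ring

/-- Shows that the zero network suffices for large ε. -/
theorem matrix_norm_exp_le {n : ℕ} {A : Matrix (Fin n) (Fin n) ℝ} {M : ℝ}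
    (hM : 1 ≤ M) (hA : ∀ i j, |A i j| ≤ M) :
    ‖NormedSpace.exp A‖ ≤ 2 * Real.exp (n * M) := by
  have h1 := norm_exp_le_norm_one_add (frobenius_norm_le_of_forall_abs_le (by linarith) hA)
  have h2 := (RowSumLE.one (n := n)).frobenius_norm_le zero_le_one
  have h3 := Real.add_one_le_exp (n * M)
  have h4 : (n : ℝ) * 1 ≤ n * M := by gcongr
  refine (h1.trans (add_le_add h2 le_rfl)).trans ?_
  linarith

/-! ### Assembly and choice of parameters -/

/-- Approximation of the exponential on matrices with entries in `[-M, M]` by a network, in terms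
of the Taylor degree `2 ^ L` and the number `m` of sawtooth layers in each multiplication. -/
theorem exists_network_exp {n : ℕ} (hn : 1 ≤ n) {M : ℝ} (hM : 1 ≤ M) (m L : ℕ)
    (hL : 4 * (Real.exp 1 * (n * M)) ≤ 2 ^ L)
    (hm : (4 : ℝ) ^ L * (2 * n ^ 2 / 4 ^ m) ≤ 1) :
    ∃ f : ReLUNetwork (n * n) (n * n),
      (∀ A : Matrix (Fin n) (Fin n) ℝ, (∀ i j, |A i j| ≤ M) →
        ‖f.evalMatrix A - NormedSpace.exp A‖ ≤
          Real.exp (n * M) * (n * (4 ^ L * (2 * n ^ 2 / 4 ^ m))) +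
            (1 / 4) ^ (2 ^ L + 1) * (4 / 3)) ∧
      f.width ≤ (2 ^ L + 1) * (n * n) * (n * 2) * 3 ∧ f.depth = L * (m + 1) + 1 := by
  have hn' : (1 : ℝ) ≤ n := by exact_mod_cast hn
  have hx : 0 < (n : ℝ) * M := by positivity
  -- The weights (nM)^k/k! undo the scaling by 1/(nM), so the polynomial is the Taylor polynomial in
  -- A.
  obtain ⟨f, hw, hd, hf⟩ := (isReLUMap_approxPoly hn m (2 ^ L) L ((n : ℝ) * M)⁻¹
    (fun k => ((n : ℝ) * M) ^ k / k.factorial)).exists_network finProdFinEquiv finProdFinEquiv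
  refine ⟨f, fun A hA => ?_, hw, hd⟩
  have hf' : f.evalMatrix A = Matrix.of fun i j => approxPoly m (2 ^ L) n L ((n : ℝ) * M)⁻¹
      (fun k => ((n : ℝ) * M) ^ k / k.factorial) (fun p => A p.1 p.2) (i, j) := by
    ext i j
    simp only [ReLUNetwork.evalMatrix, hf, Matrix.of_apply, Equiv.symm_apply_apply]
  have hrow : RowSumLE (((n : ℝ) * M)⁻¹ • A) 1 := by
    intro i
    simp only [Matrix.smul_apply, smul_eq_mul, abs_mul, abs_inv, abs_of_pos hx]
    rw [← Finset.mul_sum, inv_mul_le_iff₀ hx, mul_one]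
    refine (Finset.sum_le_sum fun j _ => hA i j).trans (le_of_eq ?_)
    simp
  have h1 := norm_approxPoly_sub_le (L := L)
    (a := fun k => ((n : ℝ) * M) ^ k / k.factorial) hrow (fun k => by positivity) hm
  have hsum : ∑ k ∈ Finset.range (2 ^ L + 1),
      (((n : ℝ) * M) ^ k / k.factorial) • (((n : ℝ) * M)⁻¹ • A) ^ k =
      ∑ k ∈ Finset.range (2 ^ L + 1), ((k.factorial : ℝ)⁻¹) • A ^ k := by
    refine Finset.sum_congr rfl fun k _ => ?_
    rw [smul_pow, smul_smul]
    congr 1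
    rw [inv_pow, div_mul_eq_mul_div, mul_inv_cancel₀ (by positivity), one_div]
  rw [← hf', hsum] at h1
  have h2 := norm_exp_sub_taylor_le (N := 2 ^ L + 1)
    (frobenius_norm_le_of_forall_abs_le (by linarith) hA) (Nat.le_add_left 1 _)
    (by push_cast; linarith)
  have h3 : ∑ k ∈ Finset.range (2 ^ L + 1), ((n : ℝ) * M) ^ k / k.factorial ≤
      Real.exp (n * M) := Real.sum_le_exp_of_nonneg hx.le _
  rw [norm_sub_rev] at h2
  refine (norm_sub_le_norm_sub_add_norm_sub _ _ _).trans (add_le_add (h1.trans ?_) h2)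
  exact mul_le_mul_of_nonneg_right h3 (by positivity)

/-- Because ln x ≥ 1 - 1/x, one has x - 1 ≤ x ln x ≤ K ln x. -/
theorem exp_sub_one_le_pow {x : ℝ} (hx : 1 ≤ x) {K : ℕ} (hK : Real.exp 1 * x ≤ K) :
    Real.exp (x - 1) ≤ x ^ K := by
  have hx0 : 0 < x := by linarith
  rw [← Real.exp_log hx0, ← Real.exp_nat_mul, Real.exp_log hx0]
  refine Real.exp_le_exp.mpr ?_
  have h1 := Real.one_sub_inv_le_log_of_pos hx0
  have h2 := Real.log_nonneg hx
  have h3 : x * (1 - x⁻¹) = x - 1 := by field_simp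
  have h4 := Real.add_one_le_exp 1
  calc x - 1 = x * (1 - x⁻¹) := h3.symm
    _ ≤ x * Real.log x := by gcongr
    _ ≤ K * Real.log x := by
        refine mul_le_mul_of_nonneg_right ?_ h2
        nlinarith

/-- The second term of the maximum defining K, used to control the Taylor tail. -/
theorem one_div_le_two_pow_of_truncationOrder {n K : ℕ} {M ε : ℝ} (hM : 0 ≤ M) (hε : 0 < ε)
    (hK : K = truncationOrder n M ε) : 1 / ε ≤ 2 ^ (K + 2) := by
  have h1 : (n * M + Real.log (√2 / (√Real.pi * ε))) / Real.log 2 - 1 ≤ K := by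
    rw [hK]
    exact (le_max_right _ _).trans (Nat.le_ceil _)
  have hl2 : 0 < Real.log 2 := Real.log_pos (by norm_num)
  have hnM : 0 ≤ n * M := by positivity
  rw [sub_le_iff_le_add, div_le_iff₀ hl2] at h1
  have h2 : √2 / (√Real.pi * ε) ≤ 2 ^ (K + 1) := by
    have h0 : 0 < √2 / (√Real.pi * ε) := by positivity
    rw [← Real.log_le_log_iff h0 (by positivity), Real.log_pow]
    push_cast
    linarith
  have h3 : √Real.pi ≤ 2 * √2 := by
    rw [Real.sqrt_le_left (by positivity), mul_pow, Real.sq_sqrt (by norm_num)]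
    linarith [Real.pi_lt_four]
  have h4 : 1 / ε ≤ 2 * (√2 / (√Real.pi * ε)) := by
    rw [← mul_div_assoc, div_le_div_iff₀ hε (by positivity)]
    nlinarith
  rw [pow_succ _ (K + 1)]
  linarith

theorem theorem1 :
    ∃ C₁ C₂ : ℝ, 0 < C₁ ∧ 0 < C₂ ∧
      ∀ (n : ℕ) (M ε : ℝ) (K : ℕ), 1 ≤ n → 1 ≤ M → 0 < ε → K = truncationOrder n M ε →
        ∃ f : ReLUNetwork (n * n) (n * n),
          (∀ A : Matrix (Fin n) (Fin n) ℝ, (∀ i j, A i j ∈ Set.Icc (-M) M) →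
            ‖f.evalMatrix A - NormedSpace.exp A‖ ≤ ε) ∧
          (f.width : ℝ) ≤ C₁ * K * (n : ℝ) ^ K ∧
          (f.depth : ℝ) ≤ C₂ * (1 + Real.log K *
            max 0 (Real.log K + Real.log (2 * Real.exp 1 / ε)
              + K * (Real.log n + Real.log M))) := by
  -- 54 comes from 6(2^L + 1) ≤ 6(8K + 1) ≤ 54K, and 60 from L ≤ 5 ln K times m + 1 ≤ 12D.
  refine ⟨54, 60, by norm_num, by norm_num, fun n M ε K hn hM hε hK => ?_⟩
  have hn' : (1 : ℝ) ≤ n := by exact_mod_cast hn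
  have hx : 1 ≤ (n : ℝ) * M := one_le_mul_of_one_le_of_one_le hn' hM
  have hx0 : 0 < (n : ℝ) * M := by linarith
  have heK : Real.exp 1 * (n * M) ≤ K := by
    rw [hK, ← mul_assoc]
    exact (le_max_left _ _).trans (Nat.le_ceil _)
  have he := Real.exp_one_gt_d9
  have hK3 : 3 ≤ K := by
    have : (2 : ℝ) < K := by nlinarith
    exact_mod_cast this
  have hK3' : (3 : ℝ) ≤ K := by exact_mod_cast hK3
  have hlogK : 1 ≤ Real.log K := by
    rw [Real.le_log_iff_exp_le (by linarith)]
    linarith [Real.exp_one_lt_d9]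
  have hnK : (n : ℝ) ≤ K := by nlinarith
  have hnpow : (n : ℝ) ^ 3 ≤ (n : ℝ) ^ K := pow_le_pow_right₀ hn' hK3
  set D := Real.log K + Real.log (2 * Real.exp 1 / ε) + K * (Real.log n + Real.log M) with hD
  have hexpD : 2 * K * Real.exp (n * M) / ε ≤ Real.exp D := by
    have h1 : Real.exp D = K * (2 * Real.exp 1 / ε) * (n * M) ^ K := by
      rw [hD, ← Real.log_mul (x := n) (by positivity) (by positivity), Real.exp_add,
        Real.exp_add, Real.exp_log (by linarith), Real.exp_log (by positivity),
        Real.exp_nat_mul, Real.exp_log hx0]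
    have h2 := exp_sub_one_le_pow hx heK
    rw [h1]
    calc 2 * K * Real.exp (n * M) / ε
        = K * (2 * Real.exp 1 / ε) * Real.exp (n * M - 1) := by
          rw [Real.exp_sub]; field_simp
      _ ≤ _ := by gcongr
  by_cases hcase : 2 * Real.exp (n * M) ≤ ε
  · refine ⟨.output 0 0, fun A hA => ?_, ?_, ?_⟩
    · have h0 : (ReLUNetwork.output 0 0 : ReLUNetwork (n * n) (n * n)).evalMatrix A = 0 := by
        ext i j
        simp [ReLUNetwork.evalMatrix, ReLUNetwork.eval]
      rw [h0, zero_sub, norm_neg]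
      exact (matrix_norm_exp_le hM fun i j => abs_le.mpr (hA i j)).trans hcase
    · simp only [ReLUNetwork.width, max_self, Nat.cast_mul]
      have : (n : ℝ) * n ≤ n ^ 3 := by nlinarith [mul_self_nonneg (n : ℝ)]
      have : 0 ≤ ((54 : ℝ) * K - 1) * n ^ K := mul_nonneg (by linarith) (by positivity)
      linarith
    · simp only [ReLUNetwork.depth, Nat.cast_one]
      have : 0 ≤ Real.log K * max 0 D := mul_nonneg (by linarith) (le_max_left _ _)
      linarith
  · push Not at hcase
    -- Here ε < 2e^(nM), so e^D ≥ K; thus D ≥ 1 and the maximum with 0 is D.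
    have hKD : Real.log K ≤ D := by
      rw [Real.log_le_iff_le_exp (by linarith)]
      refine le_trans ?_ hexpD
      rw [le_div_iff₀ hε]
      nlinarith
    have hD1 : 1 ≤ D := hlogK.trans hKD
    have hKexp : (K : ℝ) ≤ Real.exp D := (Real.log_le_iff_le_exp (by linarith)).mp hKD
    obtain ⟨L, hL1, hL2⟩ : ∃ L : ℕ, 4 * K ≤ 2 ^ L ∧ 2 ^ L < 8 * K := by
      refine ⟨Nat.clog 2 (4 * K), Nat.le_pow_clog (by norm_num) _, ?_⟩
      have := Nat.pow_pred_clog_lt_self (b := 2) (by norm_num) (x := 4 * K) (by omega)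
      have h0 : 0 < Nat.clog 2 (4 * K) := Nat.clog_pos (by norm_num) (by omega)
      obtain ⟨l, hl⟩ := Nat.exists_eq_succ_of_ne_zero h0.ne'
      rw [hl] at this ⊢
      rw [Nat.pred_succ] at this
      rw [pow_succ]
      omega
    have hL1' : 4 * (K : ℝ) ≤ 2 ^ L := by exact_mod_cast hL1
    have hL2' : (2 : ℝ) ^ L ≤ 8 * K := by exact_mod_cast hL2.le
    -- Ten factors e^D are spent: five on 128 ≤ 3^5, four on K^4, and one on 2K e^(nM)/ε, using 3 ≤
    -- K ≤ e^D.
    set m := ⌈10 * D⌉₊ with hm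
    have h4m : Real.exp D ^ 10 ≤ 4 ^ m := by
      rw [← Real.exp_nat_mul]
      have h1 : Real.exp m ≤ 4 ^ m := by
        rw [← mul_one (m : ℝ), Real.exp_nat_mul]
        exact pow_le_pow_left₀ (by positivity) (by linarith [Real.exp_one_lt_d9]) _
      refine le_trans (Real.exp_le_exp.mpr ?_) h1
      exact Nat.le_ceil _
    have h4L : (4 : ℝ) ^ L ≤ 64 * K ^ 2 := by
      have : (4 : ℝ) ^ L = (2 ^ L) ^ 2 := by rw [← pow_mul, mul_comm, pow_mul]; norm_num
      rw [this]
      calc ((2 : ℝ) ^ L) ^ 2 ≤ (8 * K) ^ 2 := by gcongr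
        _ = _ := by ring
    have hE3 : (3 : ℝ) ≤ Real.exp D := hK3'.trans hKexp
    have hpos4 : (0 : ℝ) < 4 ^ m := by positivity
    have hθ : (4 : ℝ) ^ L * (2 * n ^ 2 / 4 ^ m) ≤ 128 * K ^ 4 / 4 ^ m := by
      rw [← mul_div_assoc]
      refine div_le_div_of_nonneg_right ?_ hpos4.le
      calc (4 : ℝ) ^ L * (2 * n ^ 2) ≤ 64 * K ^ 2 * (2 * K ^ 2) := by gcongr
        _ = _ := by ring
    have h128 : 128 * (K : ℝ) ^ 4 * Real.exp D ≤ 4 ^ m := by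
      refine le_trans ?_ h4m
      calc 128 * (K : ℝ) ^ 4 * Real.exp D ≤ 3 ^ 5 * Real.exp D ^ 4 * Real.exp D := by
            gcongr; norm_num
        _ ≤ Real.exp D ^ 5 * Real.exp D ^ 4 * Real.exp D := by gcongr
        _ = _ := by ring
    have hθ1 : (4 : ℝ) ^ L * (2 * n ^ 2 / 4 ^ m) ≤ 1 := by
      refine hθ.trans ((div_le_one hpos4).mpr (le_trans ?_ h128))
      exact le_mul_of_one_le_right (by positivity) (by linarith)
    obtain ⟨f, hf, hw, hd⟩ := exists_network_exp hn hM m L (by linarith) hθ1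
    refine ⟨f, fun A hA => (hf A fun i j => abs_le.mpr (hA i j)).trans ?_, ?_, ?_⟩
    · have h1 : Real.exp (n * M) * (n * (4 ^ L * (2 * n ^ 2 / 4 ^ m))) ≤ ε / 2 := by
        calc Real.exp (n * M) * (n * (4 ^ L * (2 * n ^ 2 / 4 ^ m)))
            ≤ Real.exp (n * M) * (K * (128 * K ^ 4 / 4 ^ m)) := by gcongr
          _ = (2 * K * Real.exp (n * M) / ε) * (128 * K ^ 4) / 4 ^ m * (ε / 2) := by
              field_simp
          _ ≤ 1 * (ε / 2) := by
              refine mul_le_mul_of_nonneg_right ?_ (by positivity)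
              rw [div_le_one hpos4]
              refine le_trans ?_ h128
              rw [mul_comm (128 * (K : ℝ) ^ 4)]
              gcongr
          _ = _ := one_mul _
      have h2 : (1 / 4 : ℝ) ^ (2 ^ L + 1) * (4 / 3) ≤ ε / 2 := by
        have h3 := one_div_le_two_pow_of_truncationOrder (by linarith) hε hK
        have h4 : (2 : ℝ) ^ (K + 4) ≤ 4 ^ (2 ^ L + 1) := by
          have : (4 : ℝ) = 2 ^ 2 := by norm_num
          rw [this, ← pow_mul]
          exact pow_le_pow_right₀ (by norm_num) (by omega)
        have h5 : (2 : ℝ) ^ (K + 4) = 4 * 2 ^ (K + 2) := by ring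
        rw [one_div, inv_pow, ← one_div, div_mul_eq_mul_div, div_le_iff₀ (by positivity)]
        rw [div_le_iff₀ hε] at h3
        nlinarith
      linarith
    · have h1 : (f.width : ℝ) ≤ (2 ^ L + 1) * (n * n) * (n * 2) * 3 := by exact_mod_cast hw
      calc (f.width : ℝ) ≤ (2 ^ L + 1) * (n * n) * (n * 2) * 3 := h1
        _ = 6 * (2 ^ L + 1) * n ^ 3 := by ring
        _ ≤ 54 * K * n ^ K := by
            refine mul_le_mul ?_ hnpow (by positivity) (by positivity)
            linarith
    · have hm2 : (m : ℝ) + 1 ≤ 12 * D := by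
        have := (Nat.ceil_lt_add_one (show 0 ≤ 10 * D by linarith)).le
        rw [← hm] at this
        linarith
      have hL5 : (L : ℝ) ≤ 5 * Real.log K := by
        have h1 : (L : ℝ) * Real.log 2 ≤ Real.log (8 * K) := by
          rw [← Real.log_pow]
          exact Real.log_le_log (by positivity) hL2'
        have h8 : Real.log 8 = 3 * Real.log 2 := by
          rw [show (8 : ℝ) = 2 ^ 3 by norm_num, Real.log_pow]; norm_num
        rw [Real.log_mul (by norm_num) (by linarith), h8] at h1
        have h2 := Real.log_two_gt_d9
        nlinarith
      rw [hd, max_eq_right (by linarith : 0 ≤ D)]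
      push_cast
      have h6 : (L : ℝ) * (m + 1) ≤ 5 * Real.log K * (12 * D) :=
        mul_le_mul hL5 hm2 (by positivity) (by linarith)
      linarith
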